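/- All graphs are finite and loopless and may have parallel edges. For a graph $G$ and $S\subseteq V(G)$, let $E_G(S)$ be the multiset of edges with exactly one end in $S$. A graph parameter $\mathbf p_1$ is upper bounded by $\mathbf p_2$, written $\mathbf p_1\lesssim\mathbf p_2$, if there is $f:\mathbb N\to\mathbb N$ with $\mathbf p_1(G)\le f(\mathbf p_2(G))$ for every graph $G$; $\mathbf p_1$ and $\mathbf p_2$ are parametrically incomparable if neither $\mathbf p_1\lesssim \mathbf p_2$ nor $\mathbf p_2\lesssim\mathbf p_1$. *Edge-treewidth.* For a linear ordering $L=\langle x_1,\dots,x_n\rangle$ of $V(G)$ let $S_i=\{x_i,\dots,x_n\}$ and let $C_i$ be the vertex set of the connected component of $G[S_i]$ containing $x_i$. Then $\mathbf{etw}(G)=\min_L\max_i |E_G(C_i)|$. *Tree-cut width.* A tree-cut decomposition of $G$ is a finite tree $T$ with a family $(X_t)_{t\in V(T)}$ of pairwise disjoint, possibly empty sets with union $V(G)$. The adhesion of $e\in E(T)$ is the number of edges of $G$ between $\bigcup_{t\in T_1}X_t$ and $\bigcup_{t\in T_2}X_t$, where $T_1,T_2$ are the components of $T-e$. The torso $H_t$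 is obtained from $G$ by consolidating, for each component $T'$ of $T-t$, the set $\bigcup_{s\in T'}X_s$ to a single vertex, keeping parallel edges and removing loops. The 3-center of $(H_t,X_t)$ is obtained from $H_t$ by exhaustively suppressing vertices outside $X_t$ of degree at most two (delete the vertex and, if its degree is two, join its two neighbours by a new edge, omitted if it would be a loop). The width is the maximum over all adhesions of edges of $T$ and all numbers of vertices of the 3-centers of $(H_t,X_t)$, $t\in V(T)$; $\mathbf{tcw}(G)$ is the minimum width of a tree-cut decomposition of $G$. *Immersions, walls, thetas.* Lifting two edges $xy,xz$ with $y\ne z$ means to replace them by an edge $yz$. A graph $H$ is an immersion of $G$, $H\le_{\sf im}G$, if a graph isomorphic to $H$ is obtained from $G$ by taking subgraphs and lifting pairs of incident edges. For $r\ge2$ the wall $W_r$ is obtained from the grid on $[2r]\times[r]$ by removing the edges $\{(x,y),(x,y+1)\}$ with $x+y$ odd and then all vertices of degree one. Let $\mathbf w(G)$ be the largest $i\ge 2$ with $W_i\le_{\sf im}G$ (and $0$ if there is none). For $i\ge1$, $\theta_i$ consists of two vertices joined by $i$ parallel edges. For $i\ge2$, $Z_i$ is obtained from $|E(W_i)|$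 disjoint copies of $\theta_3$ by identifying one vertex of each copy to a single vertex. **Theorem.** 1. $\mathbf{tcw}$ and $\mathbf{etw}$ are parametrically incomparable, and so are $\mathbf w$ and $\mathbf{etw}$. 2. The values $\mathbf{tcw}(\theta_i)$ and $\mathbf w(\theta_i)$, $i\ge1$, are bounded, while the values $\mathbf{etw}(\theta_i)$, $i\ge 1$, are unbounded. 3. For every $i\ge2$, $W_i\le_{\sf im}Z_i$ and hence $\mathbf w(Z_i)\ge i$; the values $\mathbf{tcw}(Z_i)$, $i\ge2$, are unbounded, while the values $\mathbf{etw}(Z_i)$, $i\ge2$, are bounded. -/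

import Mathlib

noncomputable section

/-- A finite loopless graph, possibly with multiple edges: a finite vertex set together with a
multiset of unordered pairs of distinct vertices. -/
@[ext]
structure Multigraph (α : Type*) where
  verts : Finset α
  edges : Multiset (Sym2 α)
  mem_verts : ∀ e ∈ edges, ∀ v ∈ e, v ∈ verts
  loopless : ∀ e ∈ edges, ¬ e.IsDiag

namespace Multigraph

variable {α β : Type*}

open Classical in
/-- `E_G(S)`: the edges (with multiplicity) with one end in `S` and one end not in `S`. -/
def boundary (G : Multigraph α) (S : Set α) : Multiset (Sym2 α) :=
  G.edges.filter fun e => (∃ x ∈ e, x ∈ S) ∧ ∃ y ∈ e, y ∉ S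

/-- `|E_G(S)|`. -/
def cutSize (G : Multigraph α) (S : Set α) : ℕ :=
  (G.boundary S).card

/-- The edge-degree of a vertex. -/
def edeg (G : Multigraph α) (v : α) : ℕ :=
  G.cutSize {v}

open Classical in
/-- The subgraph `G[S]` induced by the vertices of `G` in `S`. -/
def induce (G : Multigraph α) (S : Set α) : Multigraph α where
  verts := G.verts.filter (· ∈ S)
  edges := G.edges.filter fun e => ∀ v ∈ e, v ∈ S
  mem_verts := by
    intro e he v hv
    rw [Multiset.mem_filter] at he
    exact Finset.mem_filter.2 ⟨G.mem_verts e he.1 v hv, he.2 v hv⟩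
  loopless := fun e he => G.loopless e (Multiset.mem_filter.1 he).1

open Classical in
/-- The graph with finite vertex set `s` and with the edges of the simple graph `H` between
elements of `s`. -/
def ofSimple (s : Finset α) (H : SimpleGraph α) : Multigraph α where
  verts := s
  edges := (s.sym2.filter (· ∈ H.edgeSet)).val
  mem_verts := by
    intro e he v hv
    have he' := (Finset.mem_filter.1 he).1
    exact Finset.mem_sym2_iff.1 he' v hv
  loopless := fun e he => H.not_isDiag_of_mem_edgeSet (Finset.mem_filter.1 he).2

/-! ### Edge-treewidth -/

/-- `C_G(S, v)`, for a vertex `v ∈ S`: the vertex set of the connected component of `G[S]` that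
contains `v`. -/
def component (G : Multigraph α) (S : Set α) (v : α) : Set α :=
  {w | Relation.ReflTransGen (fun a b => a ∈ S ∧ b ∈ S ∧ s(a, b) ∈ G.edges) v w}

/-- Layouts of `G`: linear orderings `⟨x_0, …, x_{n-1}⟩` of the vertices of `G`. -/
abbrev Layout (G : Multigraph α) : Type _ :=
  Fin G.verts.card ≃ G.verts

/-- `S_i = {x_i, x_{i+1}, …}`. -/
def Layout.suffix {G : Multigraph α} (L : G.Layout) (i : Fin G.verts.card) : Set α :=
  {x | ∃ j, i ≤ j ∧ (L j : α) = x}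

/-- The cost `|E_G(C_G(S_i, x_i))|` of position `i` of a layout. -/
def Layout.cost {G : Multigraph α} (L : G.Layout) (i : Fin G.verts.card) : ℕ :=
  G.cutSize (G.component (L.suffix i) (L i))

/-- The maximum cost of a position of the layout. -/
def Layout.width {G : Multigraph α} (L : G.Layout) : ℕ :=
  Finset.univ.sup L.cost

/-- Edge-treewidth: the minimum of the maximum cost over all layouts. -/
def etw (G : Multigraph α) : ℕ :=
  ⨅ L : G.Layout, L.width

/-! ### Tree-cut width -/

/-- A tree-cut decomposition of `G`: a finite tree together with a near-partition of the vertices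
of `G` (empty parts are allowed) into parts indexed by the nodes. The near-partition is given by
the map `home` sending a vertex to the node whose part contains it; the values of `home` outside
`G.verts` play no role. -/
structure TreeCutDecomposition (G : Multigraph α) where
  size : ℕ
  tree : SimpleGraph (Fin size)
  isTree : tree.IsTree
  home : α → Fin size

namespace TreeCutDecomposition

variable {G : Multigraph α} (D : TreeCutDecomposition G)

/-- The set of `x` whose node lies on the side of `u` after deletion of the tree edge `uv`. -/
def side (u v : Fin D.size) : Set α :=
  {x | (D.tree.deleteEdges {s(u, v)}).Reachable (D.home x) u}

/-- The adhesion of the tree edge `uv`: the number of edges of `G` between its two sides. -/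
def adhesion (u v : Fin D.size) : ℕ :=
  G.cutSize (D.side u v)

/-- The components of the tree minus the node `t`. -/
abbrev Branch (t : Fin D.size) : Type :=
  (D.tree.induce {t}ᶜ).ConnectedComponent

open Classical in
/-- The map which fixes the vertices in the part of `t` and consolidates, for every component of
the tree minus `t`, all vertices in parts of that component to a single vertex. -/
def toTorso (t : Fin D.size) (x : α) : α ⊕ D.Branch t :=
  if h : D.home x = t then Sum.inl x
  else Sum.inr ((D.tree.induce {t}ᶜ).connectedComponentMk ⟨D.home x, h⟩)

open Classical in
/-- The torso at `t`: consolidate every component of the tree minus `t` to a single vertex, keep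
parallel edges and remove loops. -/
def torso (t : Fin D.size) : Multigraph (α ⊕ D.Branch t) where
  verts := (G.verts.filter (D.home · = t)).image Sum.inl ∪
    (Set.finite_range (Sum.inr : D.Branch t → α ⊕ D.Branch t)).toFinset
  edges := (G.edges.map (Sym2.map (D.toTorso t))).filter fun e => ¬ e.IsDiag
  mem_verts := by
    intro e he v hv
    obtain ⟨e', he', rfl⟩ := Multiset.mem_map.1 (Multiset.mem_filter.1 he).1
    obtain ⟨x, hx, rfl⟩ := Sym2.mem_map.1 hv
    have hxG := G.mem_verts e' he' x hx
    by_cases h : D.home x = t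
    · simp [toTorso, h, hxG]
    · simp [toTorso, h]
  loopless := fun e he => (Multiset.mem_filter.1 he).2

/-- The vertices of the torso at `t` that are vertices of `G` (in the part of `t`). -/
def core (t : Fin D.size) : Set (α ⊕ D.Branch t) :=
  {w | ∃ x ∈ G.verts, D.home x = t ∧ w = Sum.inl x}

end TreeCutDecomposition

open Classical in
/-- `H'` arises from `H` by suppressing the vertex `v` of degree at most two: `v` is deleted and,
if `v` has degree two, its two neighbours are joined by a new edge (which is dropped if it would
be a loop, that is, if the two edges at `v` are parallel). -/
def IsSuppression (H : Multigraph β) (v : β) (H' : Multigraph β) : Prop :=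
  v ∈ H.verts ∧ H'.verts = H.verts.erase v ∧
    ((H.edeg v ≤ 1 ∧ H'.edges = H.edges.filter (v ∉ ·)) ∨
      ∃ a b, H.boundary {v} = {s(v, a), s(v, b)} ∧
        H'.edges = (if a = b then 0 else {s(a, b)}) + H.edges.filter (v ∉ ·))

/-- `K` is the 3-center of `(H, X)`: it is obtained from `H` by exhaustively suppressing vertices
outside `X` of degree at most two. -/
def IsThreeCenter (H : Multigraph β) (X : Set β) (K : Multigraph β) : Prop :=
  Relation.ReflTransGen (fun H₁ H₂ => ∃ v ∉ X, IsSuppression H₁ v H₂) H K ∧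
    ∀ v ∈ K.verts, v ∉ X → 3 ≤ K.edeg v

/-- The number of vertices of the 3-center of `(H, X)`. (The 3-center exists and is unique, so the
infimum is over a one-element set.) -/
def threeCenterSize (H : Multigraph β) (X : Set β) : ℕ :=
  sInf {n | ∃ K, IsThreeCenter H X K ∧ K.verts.card = n}

open Classical in
/-- The width of a tree-cut decomposition: the maximum over all adhesions of tree edges and all
orders of the 3-centers of the torsos. -/
def TreeCutDecomposition.width {G : Multigraph α} (D : TreeCutDecomposition G) : ℕ :=
  max
    ((Finset.univ.filter fun p : Fin D.size × Fin D.size => D.tree.Adj p.1 p.2).sup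
      fun p => D.adhesion p.1 p.2)
    (Finset.univ.sup fun t => threeCenterSize (D.torso t) (D.core t))

/-- Tree-cut width: the minimum width of a tree-cut decomposition. -/
def tcw (G : Multigraph α) : ℕ :=
  ⨅ D : TreeCutDecomposition G, D.width

/-! ### Immersions -/

/-- `K` is a subgraph of `G`. -/
def IsSubgraph (K G : Multigraph α) : Prop :=
  K.verts ⊆ G.verts ∧ K.edges ≤ G.edges

/-- `K` arises from `G` by lifting two edges `xy`, `xz` with `y ≠ z`: both are removed and the edge
`yz` is added. -/
def IsLifting (G K : Multigraph α) : Prop :=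
  K.verts = G.verts ∧ ∃ x y z F, y ≠ z ∧
    G.edges = s(x, y) ::ₘ s(x, z) ::ₘ F ∧ K.edges = s(y, z) ::ₘ F

open Classical in
/-- `H` and `K` are isomorphic. -/
def IsIso (H : Multigraph β) (K : Multigraph α) : Prop :=
  ∃ f : β → α, Set.InjOn f H.verts ∧ H.verts.image f = K.verts ∧
    H.edges.map (Sym2.map f) = K.edges

/-- `H` is an immersion of `G`: up to isomorphism, `H` is obtained from `G` by taking subgraphs and
lifting pairs of incident edges. -/
def IsImmersion (H : Multigraph β) (G : Multigraph α) : Prop :=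
  ∃ K : Multigraph α,
    Relation.ReflTransGen (fun G₁ G₂ => IsSubgraph G₂ G₁ ∨ IsLifting G₁ G₂) G K ∧ IsIso H K

/-! ### Thetas, walls and the graphs `Z_i` -/

/-- The `i`-theta: two vertices joined by `i` parallel edges. -/
def theta (i : ℕ) : Multigraph Bool where
  verts := Finset.univ
  edges := Multiset.replicate i s(false, true)
  mem_verts := by simp
  loopless := by
    intro e he
    rw [Multiset.eq_of_mem_replicate he]
    simp

/-- The infinite grid on `ℕ × ℕ` without its vertical edges `{(x, y), (x, y + 1)}` for odd
`x + y`. -/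
def brickLattice : SimpleGraph (ℕ × ℕ) :=
  SimpleGraph.fromRel fun p q =>
    q = (p.1 + 1, p.2) ∨ (q = (p.1, p.2 + 1) ∧ ¬ Odd (p.1 + p.2))

/-- The `(2r × r)`-grid on `[2r] × [r]` without its vertical edges `{(x, y), (x, y + 1)}` for odd
`x + y`. -/
def preWall (r : ℕ) : Multigraph (ℕ × ℕ) :=
  ofSimple (Finset.Icc 1 (2 * r) ×ˢ Finset.Icc 1 r) brickLattice

/-- The `r`-wall (for `r ≥ 2`): remove from `preWall r` all vertices of degree one. -/
def wall (r : ℕ) : Multigraph (ℕ × ℕ) :=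
  (preWall r).induce {v | (preWall r).edeg v ≠ 1}

/-- `n` copies of the `3`-theta with one vertex of each copy identified to the single vertex
`none`. -/
def thetaBouquet (n : ℕ) : Multigraph (Option (Fin n)) where
  verts := Finset.univ
  edges := ∑ j : Fin n, Multiset.replicate 3 s(none, some j)
  mem_verts := by simp
  loopless := by
    intro e he
    obtain ⟨j, -, hj⟩ := Multiset.mem_sum.1 he
    rw [Multiset.eq_of_mem_replicate hj]
    simp

/-- The graph `Z_i`: `|E(W_i)|` copies of the `3`-theta glued at one vertex. -/
def zGraph (i : ℕ) : Multigraph (Option (Fin (wall i).edges.card)) :=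
  thetaBouquet (wall i).edges.card

/-- The largest `i ≥ 2` such that the `i`-wall is an immersion of `G` (and `0` if there is none). -/
def wallImmersionNumber (G : Multigraph α) : ℕ :=
  sSup {i | 2 ≤ i ∧ IsImmersion (wall i) G}

end Multigraph

/-! ### Graph parameters -/

/-- A graph parameter is a function mapping graphs to non-negative integers. -/
abbrev GraphParameter : Type 1 :=
  ∀ α : Type, Multigraph α → ℕ

namespace GraphParameter

/-- `p ≲ q`: there is a function `f` with `p(G) ≤ f(q(G))` for every graph `G`. -/
def UpperBounded (p q : GraphParameter) : Prop :=
  ∃ f : ℕ → ℕ, ∀ (α : Type) (G : Multigraph α), p α G ≤ f (q α G)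

/-- `p` and `q` are parametrically incomparable. -/
def Incomparable (p q : GraphParameter) : Prop :=
  ¬ UpperBounded q p ∧ ¬ UpperBounded p q

/-- Edge-treewidth. -/
def etw : GraphParameter := fun _ G => G.etw

/-- Tree-cut width. -/
def tcw : GraphParameter := fun _ G => G.tcw

/-- The maximum size of a wall contained as an immersion. -/
def wallImmersion : GraphParameter := fun _ G => G.wallImmersionNumber

end GraphParameter

end

noncomputable section

namespace Multigraph

variable {α β : Type*}

/-! ### Cuts -/

/-! Two families separate the parameters. A theta has two vertices, and both `tcw` and the wall
number are at most the number of vertices; but the last vertex of any layout forms a component whose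
boundary is all `i` parallel edges. A bouquet of `3`-thetas has edge-treewidth at most 3: with the
centre first, the first component is the whole graph and every later one is a single leaf. It still
contains every graph of maximum degree at most three with no more vertices than the bouquet has
leaves. Vertices are sent to distinct leaves, and an edge `uv` arises by lifting a centre edge at
the leaf of `u` with one at the leaf of `v`. Walls qualify because they have at least as many edges
as vertices. For tree-cut width, consider the torso at the node of the centre
(`le_width_thetaBouquet`). Each image of a leaf is joined to the centre by at least three edges, so
suppression removes only isolated vertices and all images survive in the 3-center. There are thus at
most `width` images, and adhesion bounds the leaves in each, so the number of leaves is at most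
quadratic in the width. -/

theorem edeg_eq_card_filter [DecidableEq α] (G : Multigraph α) (v : α) :
    G.edeg v = (G.edges.filter (v ∈ ·)).card := by
  classical
  unfold edeg cutSize boundary
  rw [← Multiset.countP_eq_card_filter, ← Multiset.countP_eq_card_filter]
  refine Multiset.countP_congr rfl fun e he => ?_
  have hl := G.loopless e he
  induction e with
  | _ a b =>
    simp only [Sym2.mk_isDiag_iff] at hl
    simp only [Sym2.mem_iff, Set.mem_singleton_iff, exists_eq_or_imp, exists_eq_left]
    grind

/-- Without loops, each edge at `v` has `v` as an end exactly once. The count is the number of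
centre edges that the lifting construction uses at the leaf of `v`. -/
theorem count_bind_toMultiset [DecidableEq α] (G : Multigraph α) (v : α) :
    (G.edges.bind Sym2.toMultiset).count v = G.edeg v := by
  have key : ∀ E : Multiset (Sym2 α), (∀ e ∈ E, ¬ e.IsDiag) →
      (E.bind Sym2.toMultiset).count v = (E.filter (v ∈ ·)).card := by
    intro E
    induction E using Multiset.induction_on with
    | empty => simp
    | cons e E ih =>
      intro h
      rw [Multiset.cons_bind, Multiset.count_add, ih fun e he => h e (Multiset.mem_cons_of_mem he)]
      have hl := h e (Multiset.mem_cons_self e E)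
      induction e with
      | _ a b =>
        simp only [Sym2.mk_isDiag_iff] at hl
        rw [Multiset.filter_cons, Multiset.card_add]
        congr 1
        change ({a, b} : Multiset α).count v = _
        simp only [Multiset.insert_eq_cons, Multiset.count_cons, Multiset.count_singleton,
          Sym2.mem_iff]
        by_cases h1 : v = a <;> by_cases h2 : v = b <;> simp_all
  rw [edeg_eq_card_filter, key _ G.loopless]

/-! ### Immersions -/

/-- Lifting keeps the vertex set and subgraphs only shrink it. -/
theorem IsImmersion.card_verts_le {H : Multigraph β} {G : Multigraph α} (h : IsImmersion H G) :
    H.verts.card ≤ G.verts.card := by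
  classical
  obtain ⟨K, hGK, f, hf, hv, -⟩ := h
  have hsub : K.verts ⊆ G.verts := by
    clear hv
    induction hGK with
    | refl => exact subset_rfl
    | tail _ h ih =>
      rcases h with h | h
      · exact h.1.trans ih
      · exact h.1.subset.trans ih
  rw [← Finset.card_image_of_injOn hf]
  exact Finset.card_le_card (by convert hsub)

/-- Edges at a common vertex `c` that come in pairs `c (ψ a)`, `c (ψ b)` can be lifted to the edges
`(ψ a) (ψ b)` simultaneously. -/
theorem exists_lifting_star (c : α) (ψ : β → α) (E : Multiset (Sym2 β)) :
    ∀ (R : Multiset (Sym2 α)) (G : Multigraph α),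
      G.edges = (E.bind Sym2.toMultiset).map (fun v => s(c, ψ v)) + R →
      (∀ e ∈ E, ¬ (e.map ψ).IsDiag) →
      ∃ K : Multigraph α,
        Relation.ReflTransGen (fun G₁ G₂ => IsSubgraph G₂ G₁ ∨ IsLifting G₁ G₂) G K ∧
          K.verts = G.verts ∧ K.edges = E.map (Sym2.map ψ) + R := by
  induction E using Multiset.induction_on with
  | empty => exact fun R G h _ => ⟨G, .refl, rfl, by simpa using h⟩
  | cons e E ih =>
    intro R G h hE
    have hl := hE e (Multiset.mem_cons_self e E)
    induction e with
    | _ a b =>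
      have hG : G.edges = s(c, ψ a) ::ₘ s(c, ψ b) ::ₘ
          ((E.bind Sym2.toMultiset).map (fun v => s(c, ψ v)) + R) := by
        have hab : Sym2.toMultiset s(a, b) = a ::ₘ b ::ₘ 0 := rfl
        rw [h]; simp [hab]
      let G' : Multigraph α :=
        { verts := G.verts
          edges := s(ψ a, ψ b) ::ₘ ((E.bind Sym2.toMultiset).map (fun v => s(c, ψ v)) + R)
          mem_verts := by
            intro e he v hv
            rcases Multiset.mem_cons.1 he with rfl | he
            · rcases Sym2.mem_iff.1 hv with rfl | rfl
              · exact G.mem_verts s(c, ψ a) (by simp [hG]) _ (by simp)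
              · exact G.mem_verts s(c, ψ b) (by simp [hG]) _ (by simp)
            · exact G.mem_verts e (by
                rw [hG]; exact Multiset.mem_cons_of_mem (Multiset.mem_cons_of_mem he)) v hv
          loopless := by
            intro e he
            rcases Multiset.mem_cons.1 he with rfl | he
            · exact hl
            · exact G.loopless e (by
                rw [hG]; exact Multiset.mem_cons_of_mem (Multiset.mem_cons_of_mem he)) }
      have hab : ψ a ≠ ψ b := by simpa using hl
      -- The lifted edge is moved into the untouched remainder, which is why `R` is universally
      -- quantified in the induction.
      obtain ⟨K, hK, hKv, hKe⟩ := ih (s(ψ a, ψ b) ::ₘ R) G' (by simp [G'])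
        fun e he => hE e (Multiset.mem_cons_of_mem he)
      refine ⟨K, .head (b := G') (Or.inr ⟨rfl, c, ψ a, ψ b, _, hab, hG, rfl⟩) hK, hKv, ?_⟩
      rw [hKe]; simp

/-- Every graph of maximum degree at most three is an immersion of a sufficiently large bouquet of
`3`-thetas. -/
theorem isImmersion_thetaBouquet (H : Multigraph β) {n : ℕ} (hn : H.verts.card ≤ n)
    (hdeg : ∀ v, H.edeg v ≤ 3) : IsImmersion H (thetaBouquet n) := by
  classical
  rcases isEmpty_or_nonempty β with hβ | hβ
  · have hv : H.verts = ∅ := Finset.eq_empty_of_isEmpty _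
    have he : H.edges = 0 := by
      refine Multiset.eq_zero_of_forall_notMem fun e _ => ?_
      induction e with
      | _ a _ => exact isEmptyElim a
    refine ⟨⟨∅, 0, by simp, by simp⟩, .single (Or.inl ⟨by simp, by simp⟩), isEmptyElim, ?_, ?_, ?_⟩
    · exact fun x => isEmptyElim x
    · simp [hv]
    · simp [he]
  obtain ⟨φ, hφ⟩ : ∃ φ : β → Option (Fin n), Set.InjOn φ H.verts ∧ ∀ v ∈ H.verts, φ v ≠ none := by
    have : Nonempty (H.verts ↪ Fin n) := by
      rw [Function.Embedding.nonempty_iff_card_le]; simpa using hn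
    obtain ⟨g⟩ := this
    refine ⟨fun v => if h : v ∈ H.verts then some (g ⟨v, h⟩) else none, ?_, ?_⟩
    · intro a ha b hb hab
      have ha' : a ∈ H.verts := ha
      have hb' : b ∈ H.verts := hb
      simpa [ha', hb'] using hab
    · intro v hv
      simp [hv]
  -- The bouquet has enough centre edges: the leaf of `v` offers three, and `v` is an end of at most
  -- three edges.
  have hle : (H.edges.bind Sym2.toMultiset).map (fun v => s(none, φ v)) ≤
      (thetaBouquet n).edges := by
    have h1 : H.edges.bind Sym2.toMultiset ≤ ∑ v ∈ H.verts, Multiset.replicate 3 v := by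
      rw [Multiset.le_iff_count]
      intro v
      rw [count_bind_toMultiset, Multiset.count_sum']
      by_cases hv : v ∈ H.verts
      · rw [Finset.sum_eq_single_of_mem v hv]
        · simpa using hdeg v
        · intro b _ hb
          simp [hb.symm]
      · rw [edeg_eq_card_filter, Multiset.filter_eq_nil.2]
        · simp
        · exact fun e he hve => hv (H.mem_verts e he v hve)
    refine (Multiset.map_le_map h1).trans ?_
    have h2 : (∑ v ∈ H.verts, Multiset.replicate 3 v).map (fun v => s(none, φ v)) =
        ∑ o ∈ H.verts.image φ, Multiset.replicate 3 s(none, o) := by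
      rw [Finset.sum_image hφ.1, ← Multiset.coe_mapAddMonoidHom, map_sum]
      simp
    have h3 : (thetaBouquet n).edges =
        ∑ o ∈ Finset.univ.image (some : Fin n → Option (Fin n)),
          Multiset.replicate 3 s(none, o) := by
      rw [Finset.sum_image (Option.some_injective _).injOn]
      rfl
    rw [h2, h3]
    refine Finset.sum_le_sum_of_subset fun o ho => ?_
    obtain ⟨v, hv, rfl⟩ := Finset.mem_image.1 ho
    obtain ⟨j, hj⟩ := Option.ne_none_iff_exists'.1 (hφ.2 v hv)
    simp [hj]
  have hnd : ∀ e ∈ H.edges, ¬ (e.map φ).IsDiag := by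
    intro e he
    have hl := H.loopless e he
    have hm := H.mem_verts e he
    induction e with
    | _ a b =>
      simp only [Sym2.map_mk, Sym2.mk_isDiag_iff] at hl ⊢
      exact fun h => hl (hφ.1 (hm a (by simp)) (hm b (by simp)) h)
  let G₀ : Multigraph (Option (Fin n)) :=
    { verts := (thetaBouquet n).verts
      edges := (H.edges.bind Sym2.toMultiset).map (fun v => s(none, φ v))
      mem_verts := fun e he => (thetaBouquet n).mem_verts e (Multiset.mem_of_le hle he)
      loopless := fun e he => (thetaBouquet n).loopless e (Multiset.mem_of_le hle he) }
  obtain ⟨K, hK, hKv, hKe⟩ := exists_lifting_star none φ H.edges 0 G₀ (by simp [G₀]) hnd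
  rw [add_zero] at hKe
  let K' : Multigraph (Option (Fin n)) :=
    { verts := H.verts.image φ
      edges := H.edges.map (Sym2.map φ)
      mem_verts := by
        intro e he v hv
        obtain ⟨e', he', rfl⟩ := Multiset.mem_map.1 he
        obtain ⟨x, hx, rfl⟩ := Sym2.mem_map.1 hv
        exact Finset.mem_image_of_mem _ (H.mem_verts e' he' x hx)
      loopless := by
        intro e he
        obtain ⟨e', he', rfl⟩ := Multiset.mem_map.1 he
        exact hnd e' he' }
  -- Delete the unused edges, lift all pairs, then delete the unused vertices, the centre among
  -- them.
  refine ⟨K', .head (b := G₀) (Or.inl ⟨subset_rfl, hle⟩)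
    (hK.tail (c := K') (Or.inl ⟨?_, hKe.ge⟩)), φ, hφ.1, ?_, rfl⟩
  · rw [hKv]; exact fun x _ => Finset.mem_univ x
  · ext x; simp [K']

/-! ### Edge-treewidth of thetas and bouquets -/

theorem mem_component_self (G : Multigraph α) (S : Set α) (v : α) : v ∈ G.component S v :=
  Relation.ReflTransGen.refl

theorem component_eq_singleton (G : Multigraph α) {S : Set α} {v : α}
    (h : ∀ w ∈ S, s(v, w) ∉ G.edges) : G.component S v = {v} := by
  refine Set.Subset.antisymm (fun w hw => ?_) (by simpa using G.mem_component_self S v)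
  induction hw with
  | refl => rfl
  | tail _ h' ih => exact absurd (Set.mem_singleton_iff.1 ih ▸ h'.2.2) (h _ h'.2.1)

instance (G : Multigraph α) : Nonempty G.Layout :=
  ⟨G.verts.equivFin.symm⟩

theorem edeg_theta (i : ℕ) (b : Bool) : (theta i).edeg b = i := by
  rw [edeg_eq_card_filter, Multiset.filter_eq_self.2]
  · simp [theta]
  · intro e he
    rw [Multiset.eq_of_mem_replicate he]
    cases b <;> simp

theorem le_etw_theta (i : ℕ) : i ≤ (theta i).etw := by
  refine le_ciInf fun L => ?_
  have hpos : (theta i).verts.card = 2 := rfl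
  -- The last position, where the suffix is a single vertex.
  let j : Fin (theta i).verts.card := ⟨1, by omega⟩
  have hc : (theta i).component (L.suffix j) (L j) = {(L j : Bool)} := by
    refine component_eq_singleton _ ?_
    rintro w ⟨k, hk, rfl⟩ hmem
    have : k = j := by
      apply Fin.ext
      have h1 : (1 : ℕ) ≤ k := hk
      have h2 := k.2
      change (k : ℕ) = 1
      omega
    subst this
    exact (theta i).loopless _ hmem (by simp)
  have : L.cost j = i := by
    rw [Layout.cost, hc]
    exact edeg_theta i _
  calc i = L.cost j := this.symm
    _ ≤ L.width := Finset.le_sup (f := L.cost) (Finset.mem_univ j)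

theorem mem_edges_thetaBouquet {n : ℕ} {e : Sym2 (Option (Fin n))} :
    e ∈ (thetaBouquet n).edges ↔ ∃ j, e = s(none, some j) := by
  simp [thetaBouquet, Multiset.mem_sum]

theorem countP_replicate (p : α → Prop) [DecidablePred p] (m : ℕ) (a : α) :
    (Multiset.replicate m a).countP p = if p a then m else 0 := by
  induction m with
  | zero => simp
  | succ m ih =>
    rw [Multiset.replicate_succ, Multiset.countP_cons, ih]
    split_ifs <;> rfl

open Classical in
theorem cutSize_thetaBouquet {n : ℕ} (S : Set (Option (Fin n))) :
    (thetaBouquet n).cutSize S = ∑ j : Fin n, if (none ∈ S ↔ some j ∈ S) then 0 else 3 := by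
  rw [cutSize, boundary, ← Multiset.countP_eq_card_filter, thetaBouquet,
    ← Multiset.coe_countPAddMonoidHom, map_sum]
  refine Finset.sum_congr rfl fun j _ => ?_
  rw [Multiset.coe_countPAddMonoidHom]
  rw [countP_replicate]
  simp only [Sym2.mem_iff, exists_eq_or_imp, exists_eq_left]
  split_ifs <;> first | rfl | (exfalso; tauto)

theorem edeg_thetaBouquet_some {n : ℕ} (j : Fin n) : (thetaBouquet n).edeg (some j) = 3 := by
  classical
  rw [edeg, cutSize_thetaBouquet, Finset.sum_eq_single j]
  · simp
  · intro k _ hk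
    simp [hk]
  · simp

theorem etw_thetaBouquet_le (n : ℕ) : (thetaBouquet n).etw ≤ 3 := by
  have hpos : 0 < (thetaBouquet n).verts.card := Finset.card_pos.2 ⟨none, Finset.mem_univ _⟩
  let L₀ : (thetaBouquet n).Layout := (thetaBouquet n).verts.equivFin.symm
  let c : (thetaBouquet n).verts := ⟨none, Finset.mem_univ _⟩
  -- An arbitrary layout, modified so that the centre comes first.
  let L : (thetaBouquet n).Layout := L₀.trans (Equiv.swap (L₀ ⟨0, hpos⟩) c)
  have hL : L ⟨0, hpos⟩ = c := by simp [L]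
  refine (ciInf_le' _ L).trans (Finset.sup_le fun i _ => ?_)
  rcases hi : (L i : Option (Fin n)) with _ | j
  · have hi0 : i = ⟨0, hpos⟩ := L.injective (by rw [hL]; exact Subtype.ext hi)
    have hS : ∀ x, x ∈ L.suffix i := fun x =>
      ⟨L.symm ⟨x, Finset.mem_univ _⟩, by rw [hi0]; exact Nat.zero_le _, by simp⟩
    have hC : ∀ x, x ∈ (thetaBouquet n).component (L.suffix i) none := by
      rintro (_ | k)
      · exact mem_component_self _ _ _
      · exact .single ⟨hS _, hS _, mem_edges_thetaBouquet.2 ⟨k, rfl⟩⟩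
    rw [Layout.cost, hi, cutSize_thetaBouquet]
    simp [hC]
  · rw [Layout.cost, hi, component_eq_singleton]
    · exact (edeg_thetaBouquet_some j).le
    · rintro w ⟨k, hk, rfl⟩ hmem
      obtain ⟨l, hl⟩ := mem_edges_thetaBouquet.1 hmem
      have hk0 : (L k : Option (Fin n)) = none := by
        rcases hk' : (L k : Option (Fin n)) with _ | m
        · rfl
        · simp [hk'] at hl
      have hk1 : k = ⟨0, hpos⟩ := L.injective (by rw [hL]; exact Subtype.ext hk0)
      have hi0 : i = ⟨0, hpos⟩ := by
        apply Fin.ext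
        have : (i : ℕ) ≤ k := hk
        rw [hk1] at this
        exact Nat.le_zero.1 this
      rw [hi0, hL] at hi
      simp [c] at hi

/-! ### Tree-cut width: general facts -/

/-- The tree-cut decomposition whose tree has a single node. -/
def trivialDecomposition (G : Multigraph α) : TreeCutDecomposition G where
  size := 1
  tree := ⊥
  isTree := .of_subsingleton
  home := fun _ => 0

instance (G : Multigraph α) : Nonempty (TreeCutDecomposition G) :=
  ⟨G.trivialDecomposition⟩

/-- A one-node tree has no adhesions and no branches; every torso vertex lies in the core, so the
torso is its own 3-center. -/
theorem tcw_le_card_verts (G : Multigraph α) : G.tcw ≤ G.verts.card := by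
  classical
  refine (ciInf_le' _ G.trivialDecomposition).trans (max_le ?_ ?_)
  · refine Finset.sup_le fun p hp => ?_
    exact absurd (Finset.mem_filter.1 hp).2 (by simp [trivialDecomposition])
  · refine Finset.sup_le fun t _ => ?_
    have hbranch : IsEmpty (G.trivialDecomposition.Branch t) := by
      refine ⟨fun b => ?_⟩
      induction b using SimpleGraph.ConnectedComponent.ind with
      | _ v => exact v.2 (Subsingleton.elim (α := Fin 1) _ _)
    have hverts : (G.trivialDecomposition.torso t).verts ⊆ G.verts.image Sum.inl := by
      rintro (x | b) hw
      · have hx : x ∈ G.verts ∧ G.trivialDecomposition.home x = t := by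
          simpa [TreeCutDecomposition.torso] using hw
        simpa using hx.1
      · exact isEmptyElim b
    have hcenter : IsThreeCenter (G.trivialDecomposition.torso t) (G.trivialDecomposition.core t)
        (G.trivialDecomposition.torso t) := by
      refine ⟨.refl, fun v hv hX => ?_⟩
      obtain ⟨x, hx, rfl⟩ := Finset.mem_image.1 (hverts hv)
      exact absurd ⟨x, hx, Subsingleton.elim (α := Fin 1) _ _, rfl⟩ hX
    have hsize : threeCenterSize (G.trivialDecomposition.torso t)
        (G.trivialDecomposition.core t) ≤ (G.trivialDecomposition.torso t).verts.card :=
      Nat.sInf_le ⟨_, hcenter, rfl⟩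
    exact hsize.trans
      ((Finset.card_le_card hverts).trans Finset.card_image_le)

/-- A suppressed vertex has degree at most two, hence is isolated by hypothesis. This rules out the
alternative that joins two neighbours. -/
theorem IsSuppression.edges_eq {H K : Multigraph β} {v : β} (h : IsSuppression H v K)
    (hv : H.edeg v ≤ 2 → ∀ e ∈ H.edges, v ∉ e) : K.edges = H.edges := by
  classical
  obtain ⟨-, -, ⟨hdeg, hK⟩ | ⟨a, b, hab, -⟩⟩ := h
  · rw [hK]
    exact Multiset.filter_eq_self.2 (hv (hdeg.trans one_le_two))
  · have hdeg : H.edeg v ≤ 2 := by rw [edeg, cutSize, hab]; rfl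
    have hmem : s(v, a) ∈ H.boundary {v} := by simp [hab]
    exact absurd (Sym2.mem_mk_left v a) (hv hdeg _ (Multiset.mem_filter.1 hmem).1)

theorem edeg_congr {H K : Multigraph β} (h : K.edges = H.edges) (v : β) : K.edeg v = H.edeg v := by
  simp only [edeg, cutSize, boundary, h]

/-- If all vertices outside `X` of degree at most two are isolated, then the 3-center has the same
edges. -/
theorem IsThreeCenter.edges_eq {H K : Multigraph β} {X : Set β} (h : IsThreeCenter H X K)
    (hX : ∀ v ∉ X, H.edeg v ≤ 2 → ∀ e ∈ H.edges, v ∉ e) : K.edges = H.edges := by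
  obtain ⟨h, -⟩ := h
  induction h with
  | refl => rfl
  | tail _ h ih =>
    obtain ⟨v, hv, hs⟩ := h
    rw [hs.edges_eq, ih]
    rw [edeg_congr ih, ih]
    exact hX v hv

/-- Isolated vertices are deleted one at a time. Existence matters because `threeCenterSize` is an
`sInf`, which would be 0 on the empty set. -/
theorem exists_isThreeCenter {H : Multigraph β} {X : Set β}
    (hX : ∀ v ∉ X, H.edeg v ≤ 2 → ∀ e ∈ H.edges, v ∉ e) : ∃ K, IsThreeCenter H X K := by
  classical
  induction hn : H.verts.card using Nat.strong_induction_on generalizing H with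
  | _ n ih =>
    by_cases h : ∀ v ∈ H.verts, v ∉ X → 3 ≤ H.edeg v
    · exact ⟨H, .refl, h⟩
    · push Not at h
      obtain ⟨v, hv, hvX, hdeg⟩ := h
      have hiso := hX v hvX (by omega)
      let H' : Multigraph β :=
        { verts := H.verts.erase v
          edges := H.edges
          mem_verts := fun e he w hw =>
            Finset.mem_erase.2 ⟨fun h => hiso e he (h ▸ hw), H.mem_verts e he w hw⟩
          loopless := H.loopless }
      have hs : IsSuppression H v H' := by
        refine ⟨hv, rfl, Or.inl ⟨?_, ?_⟩⟩
        · rw [edeg, cutSize, boundary, Multiset.filter_eq_nil.2]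
          · simp
          · rintro e he ⟨⟨x, hx, rfl⟩, -⟩
            exact hiso e he hx
        · exact (Multiset.filter_eq_self.2 hiso).symm
      obtain ⟨K, hK⟩ := ih _ (hn ▸ Finset.card_erase_lt_of_mem hv) (H := H')
        (fun v hv hd => hX v hv (by rwa [edeg_congr (H := H) (K := H') rfl] at hd)) rfl
      exact ⟨K, .head ⟨v, hvX, hs⟩ hK.1, hK.2⟩

namespace TreeCutDecomposition

variable {G : Multigraph α} (D : TreeCutDecomposition G)

theorem adhesion_le_width {u v : Fin D.size} (h : D.tree.Adj u v) : D.adhesion u v ≤ D.width := by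
  classical
  exact le_max_of_le_left (Finset.le_sup (f := fun p : Fin D.size × Fin D.size =>
    D.adhesion p.1 p.2) (b := (u, v)) (by simpa using h))

theorem threeCenterSize_le_width (t : Fin D.size) :
    threeCenterSize (D.torso t) (D.core t) ≤ D.width :=
  le_max_of_le_right (Finset.le_sup (f := fun t => threeCenterSize (D.torso t) (D.core t))
    (Finset.mem_univ t))

theorem exists_mem_edges_of_mem_torso_edges {t : Fin D.size} {e : Sym2 (α ⊕ D.Branch t)}
    (he : e ∈ (D.torso t).edges) : ∃ e' ∈ G.edges, e'.map (D.toTorso t) = e := by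
  classical
  exact Multiset.mem_map.1 (Multiset.mem_filter.1 he).1

/-- Every branch at `t` is one of the sides of an edge at `t`. -/
theorem exists_adj_side (t : Fin D.size) (B : D.Branch t) :
    ∃ u, D.tree.Adj u t ∧ (∀ x, D.home x = t → x ∉ D.side u t) ∧
      ∀ x, D.toTorso t x = Sum.inr B → x ∈ D.side u t := by
  classical
  induction B using SimpleGraph.ConnectedComponent.ind with
  | _ b =>
    obtain ⟨b, hb⟩ := b
    obtain ⟨p, hp⟩ := (D.isTree.connected t b).exists_isPath
    cases p with
    | nil => exact absurd rfl hb
    -- `u` is the first node after `t` on the path into the branch; the rest of the path avoids `t`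
    -- and so stays inside the branch.
    | @cons _ u _ hadj q =>
      rw [SimpleGraph.Walk.cons_isPath_iff] at hp
      have hq : ∀ x ∈ q.support, x ∈ ({t}ᶜ : Set (Fin D.size)) := fun x hx hxt =>
        hp.2 (Set.mem_singleton_iff.1 hxt ▸ hx)
      have hub := (q.induce _ hq).reachable
      refine ⟨u, hadj.symm, fun x hx h => ?_, fun x hx => ?_⟩
      · have hbr := SimpleGraph.isAcyclic_iff_forall_adj_isBridge.1 D.isTree.isAcyclic hadj.symm
        rw [SimpleGraph.isBridge_iff] at hbr
        exact hbr (hx ▸ h : (D.tree.deleteEdges {s(u, t)}).Reachable t u).symm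
      · unfold toTorso at hx
        split_ifs at hx with hxt
        have hxb := SimpleGraph.ConnectedComponent.exact (Sum.inr_injective hx)
        let f : D.tree.induce {t}ᶜ →g D.tree.deleteEdges {s(u, t)} :=
          ⟨Subtype.val, by
            intro a b hab
            rw [SimpleGraph.deleteEdges_adj]
            refine ⟨hab, fun h => ?_⟩
            have ht : t ∈ s(a.1, b.1) := by
              rw [Set.mem_singleton_iff.1 h]; simp
            rcases Sym2.mem_iff.1 ht with h | h
            · exact a.2 h.symm
            · exact b.2 h.symm⟩
        exact (hxb.trans hub.symm).map f

end TreeCutDecomposition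

/-! ### Tree-cut width of bouquets -/

section Bouquet

variable {n : ℕ} (D : TreeCutDecomposition (thetaBouquet n))

theorem toTorso_none : D.toTorso (D.home none) none = Sum.inl none := by
  simp [TreeCutDecomposition.toTorso]

theorem toTorso_some_ne (t : Fin D.size) (j : Fin n) : D.toTorso t (some j) ≠ Sum.inl none := by
  unfold TreeCutDecomposition.toTorso
  split_ifs <;> simp

/-- The image of a leaf is never the centre, so its three edges do not become loops. -/
theorem replicate_le_torso_edges (j : Fin n) :
    Multiset.replicate 3 s(Sum.inl none, D.toTorso (D.home none) (some j)) ≤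
      (D.torso (D.home none)).edges := by
  classical
  have h : Multiset.replicate 3 s(none, some j) ≤ (thetaBouquet n).edges :=
    Finset.single_le_sum (f := fun j : Fin n => Multiset.replicate 3 s(none, some j))
      (fun _ _ => Multiset.zero_le _) (Finset.mem_univ j)
  have h2 := Multiset.filter_le_filter (fun e => ¬ e.IsDiag)
    (Multiset.map_le_map (f := Sym2.map (D.toTorso (D.home none))) h)
  rw [Multiset.map_replicate, Multiset.filter_eq_self.2] at h2
  · rw [Sym2.map_mk, toTorso_none] at h2
    convert h2
    simp only [TreeCutDecomposition.torso]
    congr!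
  · intro e he
    rw [Multiset.eq_of_mem_replicate he, Sym2.map_mk, Sym2.mk_isDiag_iff, toTorso_none]
    exact (toTorso_some_ne D _ j).symm

theorem torso_isolated_of_edeg_le_two :
    ∀ v ∉ D.core (D.home none), (D.torso (D.home none)).edeg v ≤ 2 →
      ∀ e ∈ (D.torso (D.home none)).edges, v ∉ e := by
  classical
  intro v hv hdeg e he hve
  obtain ⟨e', he', rfl⟩ := D.exists_mem_edges_of_mem_torso_edges he
  obtain ⟨j, rfl⟩ := mem_edges_thetaBouquet.1 he'
  rw [Sym2.map_mk, toTorso_none, Sym2.mem_iff] at hve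
  rcases hve with rfl | rfl
  · exact hv ⟨none, Finset.mem_univ _, rfl, rfl⟩
  · have h := Multiset.card_le_card (Multiset.filter_le_filter
      (fun e => D.toTorso (D.home none) (some j) ∈ e) (replicate_le_torso_edges D j))
    rw [Multiset.filter_eq_self.2, Multiset.card_replicate, ← edeg_eq_card_filter] at h
    · omega
    · intro e he
      rw [Multiset.eq_of_mem_replicate he]
      simp

/-- A core vertex is the image of at most one leaf. A branch lies across a tree edge from the
centre, and each of its leaves adds 3 to that adhesion; the factor 3 is not exploited. The bound
`D.width + 1` covers both cases. -/
theorem card_fiber_toTorso_le [DecidableEq (Option (Fin n) ⊕ D.Branch (D.home none))]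
    (w : Option (Fin n) ⊕ D.Branch (D.home none)) :
    (Finset.univ.filter fun j : Fin n => D.toTorso (D.home none) (some j) = w).card ≤
      D.width + 1 := by
  classical
  rcases w with x | B
  · refine (Finset.card_le_one.2 fun a ha b hb => ?_).trans (Nat.le_add_left 1 _)
    have key : ∀ c : Fin n, D.toTorso (D.home none) (some c) = Sum.inl x → some c = x := by
      intro c hc
      unfold TreeCutDecomposition.toTorso at hc
      split_ifs at hc
      exact Sum.inl_injective hc
    exact Option.some_injective _
      ((key a (Finset.mem_filter.1 ha).2).trans (key b (Finset.mem_filter.1 hb).2).symm)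
  · obtain ⟨u, hadj, hnone, hB⟩ := D.exists_adj_side _ B
    refine le_trans ?_ ((D.adhesion_le_width hadj).trans (Nat.le_succ _))
    rw [TreeCutDecomposition.adhesion, cutSize_thetaBouquet, Finset.card_filter]
    refine Finset.sum_le_sum fun j _ => ?_
    have hn := hnone none rfl
    split_ifs with h1 h2
    · exact absurd (h2.2 (hB _ h1)) hn
    all_goals omega

theorem le_width_thetaBouquet : n ≤ (D.width + 1) * D.width := by
  classical
  have hX := torso_isolated_of_edeg_le_two D
  obtain ⟨K₀, hK₀⟩ := exists_isThreeCenter hX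
  -- A 3-center attaining the infimum.
  obtain ⟨K, hK, hcard⟩ := Nat.sInf_mem
    (s := {m | ∃ K, IsThreeCenter (D.torso (D.home none)) (D.core (D.home none)) K ∧
      K.verts.card = m}) ⟨_, K₀, hK₀, rfl⟩
  have hKw : K.verts.card ≤ D.width := hcard.trans_le (D.threeCenterSize_le_width _)
  have himg : (Finset.univ.image fun j : Fin n => D.toTorso (D.home none) (some j)) ⊆ K.verts := by
    intro w hw
    obtain ⟨j, -, rfl⟩ := Finset.mem_image.1 hw
    refine K.mem_verts s(Sum.inl none, D.toTorso (D.home none) (some j)) ?_ _ (by simp)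
    rw [hK.edges_eq hX]
    exact Multiset.mem_of_le (replicate_le_torso_edges D j) (by simp)
  calc n = (Finset.univ : Finset (Fin n)).card := by simp
    _ ≤ (D.width + 1) * _ := Finset.card_le_mul_card_image _ _ fun w _ => card_fiber_toTorso_le D w
    _ ≤ (D.width + 1) * D.width :=
        Nat.mul_le_mul_left _ ((Finset.card_le_card himg).trans hKw)

end Bouquet

theorem lt_tcw_thetaBouquet {n k : ℕ} (h : (k + 1) * k < n) : k < (thetaBouquet n).tcw := by
  refine Nat.succ_le_iff.1 (le_ciInf fun D => ?_)
  by_contra hk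
  have hk' : D.width ≤ k := by omega
  exact absurd (le_width_thetaBouquet D)
    (not_le.2 (lt_of_le_of_lt (Nat.mul_le_mul (by omega) hk') h))

/-! ### Walls -/

theorem edges_induce_le (G : Multigraph α) (S : Set α) : (G.induce S).edges ≤ G.edges := by
  classical
  exact Multiset.filter_le _ _

theorem mem_verts_induce {G : Multigraph α} {S : Set α} {v : α} :
    v ∈ (G.induce S).verts ↔ v ∈ G.verts ∧ v ∈ S := by
  classical
  simp [induce]

theorem edeg_mono {G K : Multigraph α} (h : K.edges ≤ G.edges) (v : α) : K.edeg v ≤ G.edeg v := by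
  classical
  rw [edeg_eq_card_filter, edeg_eq_card_filter]
  exact Multiset.card_le_card (Multiset.filter_le_filter _ h)

/-- The edges of a brick lattice at `(x, y)` lead to `(x ± 1, y)` and to one of `(x, y ± 1)`. -/
theorem brickLattice_adj {p q : ℕ × ℕ} (h : brickLattice.Adj p q) :
    q = (p.1 + 1, p.2) ∨ q = (p.1 - 1, p.2) ∨
      q = (p.1, if Odd (p.1 + p.2) then p.2 - 1 else p.2 + 1) := by
  obtain ⟨x, y⟩ := p
  obtain ⟨x', y'⟩ := q
  simp only [brickLattice, SimpleGraph.fromRel_adj, Prod.mk.injEq, ne_eq] at h ⊢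
  split_ifs with ho <;> grind

theorem brickLattice_adj_horizontal (x y : ℕ) : brickLattice.Adj (x, y) (x + 1, y) := by
  simp [brickLattice, SimpleGraph.fromRel_adj]

theorem brickLattice_adj_vertical {x y : ℕ} (h : ¬ Odd (x + y)) :
    brickLattice.Adj (x, y) (x, y + 1) := by
  rw [brickLattice, SimpleGraph.fromRel_adj]
  exact ⟨by simp, Or.inl (Or.inr ⟨rfl, h⟩)⟩

theorem nodup_edges_preWall (r : ℕ) : (preWall r).edges.Nodup :=
  Finset.nodup _

theorem mem_edges_preWall {r : ℕ} {p q : ℕ × ℕ} :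
    s(p, q) ∈ (preWall r).edges ↔
      p ∈ (preWall r).verts ∧ q ∈ (preWall r).verts ∧ brickLattice.Adj p q := by
  simp only [preWall, ofSimple, Finset.mem_val, Finset.mem_filter, Finset.mk_mem_sym2_iff,
    SimpleGraph.mem_edgeSet, and_assoc]

theorem mem_verts_preWall {r x y : ℕ} :
    (x, y) ∈ (preWall r).verts ↔ (1 ≤ x ∧ x ≤ 2 * r) ∧ 1 ≤ y ∧ y ≤ r := by
  simp [preWall, ofSimple]

theorem edeg_preWall_le (r : ℕ) (v : ℕ × ℕ) : (preWall r).edeg v ≤ 3 := by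
  classical
  rw [edeg_eq_card_filter]
  have hsub : (preWall r).edges.filter (v ∈ ·) ≤
      ({s(v, (v.1 + 1, v.2)), s(v, (v.1 - 1, v.2)),
        s(v, (v.1, if Odd (v.1 + v.2) then v.2 - 1 else v.2 + 1))} : Multiset _) := by
    refine (Multiset.le_iff_subset ((nodup_edges_preWall r).filter _)).2 fun e he => ?_
    obtain ⟨he, hv⟩ := Multiset.mem_filter.1 he
    obtain ⟨w, rfl⟩ := Sym2.mem_iff_exists.1 hv
    have := brickLattice_adj (mem_edges_preWall.1 he).2.2
    simp only [Multiset.insert_eq_cons, Multiset.mem_cons, Multiset.mem_singleton]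
    rcases this with h | h | h
    · exact Or.inl (by rw [← h])
    · exact Or.inr (Or.inl (by rw [← h]))
    · exact Or.inr (Or.inr (by rw [← h]))
  exact (Multiset.card_le_card hsub).trans (by simp)

theorem edeg_wall_le (r : ℕ) (v : ℕ × ℕ) : (wall r).edeg v ≤ 3 :=
  (edeg_mono (edges_induce_le _ _) v).trans (edeg_preWall_le r v)

/-- An edge assigned injectively to each vertex of `preWall r`: the edge to the right, where there
is one, and one of the left-most vertical edges for the vertices of the last column. -/
def preWallEdge (r : ℕ) (p : ℕ × ℕ) : Sym2 (ℕ × ℕ) :=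
  if p.1 < 2 * r then s(p, (p.1 + 1, p.2))
  else if p.2 < r then
    if Odd p.2 then s((1, p.2), (1, p.2 + 1)) else s((2, p.2), (2, p.2 + 1))
  else s((3, 1), (3, 2))

/-- Each row is a path, one edge short of its number of vertices. The deficit of `r` is made up by
one vertical edge above each row but the last, in column 1 or 2 by parity, and a second one in
column 3 above the first row, which exists since `2 ≤ r`. -/
theorem card_verts_preWall_le {r : ℕ} (hr : 2 ≤ r) :
    (preWall r).verts.card ≤ (preWall r).edges.card := by
  classical
  rw [← Multiset.toFinset_card_of_nodup (nodup_edges_preWall r)]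
  refine Finset.card_le_card_of_injOn (preWallEdge r) ?_ ?_
  · rintro ⟨x, y⟩ hp
    have hp' := mem_verts_preWall.1 hp
    simp only [Finset.mem_coe, Multiset.mem_toFinset, preWallEdge]
    split_ifs with h1 h2 h3
    · exact mem_edges_preWall.2 ⟨hp, mem_verts_preWall.2 (by omega),
        brickLattice_adj_horizontal x y⟩
    · refine mem_edges_preWall.2 ⟨mem_verts_preWall.2 (by omega), mem_verts_preWall.2 (by omega),
        brickLattice_adj_vertical ?_⟩
      grind
    · refine mem_edges_preWall.2 ⟨mem_verts_preWall.2 (by omega), mem_verts_preWall.2 (by omega),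
        brickLattice_adj_vertical ?_⟩
      grind
    · exact mem_edges_preWall.2 ⟨mem_verts_preWall.2 (by omega), mem_verts_preWall.2 (by omega),
        brickLattice_adj_vertical (by decide)⟩
  · rintro ⟨x, y⟩ hp ⟨x', y'⟩ hp' h
    have h1 := mem_verts_preWall.1 hp
    have h2 := mem_verts_preWall.1 hp'
    simp only [preWallEdge] at h
    split_ifs at h <;> simp only [Sym2.eq_iff, Prod.mk.injEq] at h ⊢ <;> grind

/-- Passing from `preWall r` to the wall, each deleted vertex has degree one and takes at most one
edge with it, so the inequality persists. -/
theorem card_verts_wall_le {r : ℕ} (hr : 2 ≤ r) :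
    (wall r).verts.card ≤ (wall r).edges.card := by
  classical
  set P := preWall r with hP
  have hE : (wall r).edges.card + (P.edges.filter fun e => ¬ ∀ v ∈ e, P.edeg v ≠ 1).card =
      P.edges.card := by
    rw [← Multiset.card_add]
    congr 1
    convert Multiset.filter_add_not (fun e => ∀ v ∈ e, P.edeg v ≠ 1) P.edges
    simp only [wall, induce]
    congr!
  have hV : (wall r).verts.card + (P.verts.filter fun v => ¬ P.edeg v ≠ 1).card =
      P.verts.card := by
    convert Finset.card_filter_add_card_filter_not (s := P.verts) (fun v => P.edeg v ≠ 1)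
    simp only [wall, induce]
    congr!
  have hrem : (P.edges.filter fun e => ¬ ∀ v ∈ e, P.edeg v ≠ 1).card ≤
      (P.verts.filter fun v => ¬ P.edeg v ≠ 1).card := by
    have hnd := nodup_edges_preWall r
    calc _ = (P.edges.filter fun e => ¬ ∀ v ∈ e, P.edeg v ≠ 1).toFinset.card :=
          (Multiset.toFinset_card_of_nodup (hnd.filter _)).symm
      _ ≤ ((P.verts.filter fun v => ¬ P.edeg v ≠ 1).biUnion fun v =>
            (P.edges.filter (v ∈ ·)).toFinset).card := by
          refine Finset.card_le_card fun e he => ?_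
          obtain ⟨he, hv⟩ := Multiset.mem_filter.1 (Multiset.mem_toFinset.1 he)
          push Not at hv
          obtain ⟨v, hve, hv⟩ := hv
          exact Finset.mem_biUnion.2 ⟨v, Finset.mem_filter.2 ⟨P.mem_verts e he v hve, by simpa⟩,
            Multiset.mem_toFinset.2 (Multiset.mem_filter.2 ⟨he, hve⟩)⟩
      _ ≤ _ := Finset.card_biUnion_le
      _ ≤ ∑ v ∈ P.verts.filter fun v => ¬ P.edeg v ≠ 1, 1 := by
          refine Finset.sum_le_sum fun v hv => ?_
          have hv1 : P.edeg v = 1 := by simpa using (Finset.mem_filter.1 hv).2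
          rw [Multiset.toFinset_card_of_nodup (hnd.filter _), ← edeg_eq_card_filter, hv1]
      _ = _ := by simp
  have hle : P.verts.card ≤ P.edges.card := card_verts_preWall_le hr
  omega

/-- The inner vertices of the first row keep both horizontal edges, so they do not have degree one.
-/
theorem le_card_verts_wall {r : ℕ} (hr : 2 ≤ r) : 2 * r - 2 ≤ (wall r).verts.card := by
  classical
  have hsub : (Finset.Icc 2 (2 * r - 1)).image (fun x => (x, 1)) ⊆ (wall r).verts := by
    intro p hp
    obtain ⟨x, hx, rfl⟩ := Finset.mem_image.1 hp
    rw [Finset.mem_Icc] at hx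
    obtain ⟨x, rfl⟩ : ∃ z, x = z + 1 := ⟨x - 1, by omega⟩
    refine mem_verts_induce.2 ⟨mem_verts_preWall.2 (by omega), fun hdeg => ?_⟩
    rw [edeg_eq_card_filter, Multiset.card_eq_one] at hdeg
    obtain ⟨e, he⟩ := hdeg
    have h1 : s((x + 1, 1), (x + 2, 1)) ∈ (preWall r).edges.filter ((x + 1, 1) ∈ ·) :=
      Multiset.mem_filter.2 ⟨mem_edges_preWall.2 ⟨mem_verts_preWall.2 (by omega),
        mem_verts_preWall.2 (by omega), brickLattice_adj_horizontal _ _⟩, by simp⟩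
    have h2 : s((x, 1), (x + 1, 1)) ∈ (preWall r).edges.filter ((x + 1, 1) ∈ ·) :=
      Multiset.mem_filter.2 ⟨mem_edges_preWall.2 ⟨mem_verts_preWall.2 (by omega),
        mem_verts_preWall.2 (by omega), brickLattice_adj_horizontal _ _⟩, by simp⟩
    rw [he, Multiset.mem_singleton] at h1 h2
    have h := h1.trans h2.symm
    simp at h
  calc 2 * r - 2 = ((Finset.Icc 2 (2 * r - 1)).image (fun x => (x, 1))).card := by
        rw [Finset.card_image_of_injective _ fun a b h => (Prod.mk.inj h).1, Nat.card_Icc]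
        omega
    _ ≤ _ := Finset.card_le_card hsub

theorem IsImmersion.wall_le_card_verts {r : ℕ} {G : Multigraph α} (hr : 2 ≤ r)
    (h : IsImmersion (wall r) G) : r ≤ G.verts.card := by
  have h1 := le_card_verts_wall hr
  have h2 := h.card_verts_le
  omega

theorem wallImmersionNumber_le_card_verts (G : Multigraph α) :
    G.wallImmersionNumber ≤ G.verts.card := by
  rcases Set.eq_empty_or_nonempty {i | 2 ≤ i ∧ IsImmersion (wall i) G} with h | h
  · rw [wallImmersionNumber, h]
    simp
  · exact csSup_le h fun i hi => hi.2.wall_le_card_verts hi.1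

/-- The vertex count bounds the set of immersed walls; an unbounded set would have `sSup` equal to
0. -/
theorem IsImmersion.le_wallImmersionNumber {r : ℕ} {G : Multigraph α} (hr : 2 ≤ r)
    (h : IsImmersion (wall r) G) : r ≤ G.wallImmersionNumber :=
  le_csSup ⟨G.verts.card, fun _ hi => hi.2.wall_le_card_verts hi.1⟩ ⟨hr, h⟩

theorem isImmersion_wall_zGraph {r : ℕ} (hr : 2 ≤ r) : IsImmersion (wall r) (zGraph r) :=
  isImmersion_thetaBouquet _ (card_verts_wall_le hr) (edeg_wall_le r)

theorem le_card_edges_wall {r : ℕ} (hr : 2 ≤ r) : r ≤ (wall r).edges.card := by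
  have h1 := le_card_verts_wall hr
  have h2 := card_verts_wall_le hr
  omega

end Multigraph

end

/-! ### Incomparability of the parameters -/

open Multigraph

/-- On graphs with `q` at most `c`, a bounding function takes only finitely many values, so their
maximum would bound `p`. -/
theorem GraphParameter.not_upperBounded {p q : GraphParameter} (c : ℕ)
    (h : ∀ k, ∃ (α : Type) (G : Multigraph α), k < p α G ∧ q α G ≤ c) : ¬ p.UpperBounded q := by
  rintro ⟨f, hf⟩
  obtain ⟨α, G, hk, hc⟩ := h ((Finset.range (c + 1)).sup f)
  have h1 := hf α G
  have h2 : f (q α G) ≤ (Finset.range (c + 1)).sup f :=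
    Finset.le_sup (Finset.mem_range.2 (by omega))
  omega

theorem mainTheorem11 :
    -- the two parameters are incomparable
    GraphParameter.Incomparable GraphParameter.tcw GraphParameter.etw ∧
    -- so are edge-treewidth and the maximum size of an immersed wall
    GraphParameter.Incomparable GraphParameter.wallImmersion GraphParameter.etw ∧
    -- thetas have bounded tree-cut width and immersed walls, but unbounded edge-treewidth
    (∃ c : ℕ, ∀ i : ℕ, 1 ≤ i → (Multigraph.theta i).tcw ≤ c) ∧
    (∃ c : ℕ, ∀ i : ℕ, 1 ≤ i → (Multigraph.theta i).wallImmersionNumber ≤ c) ∧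
    (∀ k : ℕ, ∃ i : ℕ, 1 ≤ i ∧ k < (Multigraph.theta i).etw) ∧
    -- the graphs `Z_i` contain the walls as immersions, have unbounded tree-cut width,
    -- but bounded edge-treewidth
    (∀ i : ℕ, 2 ≤ i → Multigraph.IsImmersion (Multigraph.wall i) (Multigraph.zGraph i)) ∧
    (∀ i : ℕ, 2 ≤ i → i ≤ (Multigraph.zGraph i).wallImmersionNumber) ∧
    (∀ k : ℕ, ∃ i : ℕ, 2 ≤ i ∧ k < (Multigraph.zGraph i).tcw) ∧
    (∃ c : ℕ, ∀ i : ℕ, 2 ≤ i → (Multigraph.zGraph i).etw ≤ c) := by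
  have tcw_theta : ∀ i, (theta i).tcw ≤ 2 := fun i => (theta i).tcw_le_card_verts
  have wall_theta : ∀ i, (theta i).wallImmersionNumber ≤ 2 := fun i =>
    (theta i).wallImmersionNumber_le_card_verts
  have etw_theta : ∀ k, k < (theta (k + 1)).etw := fun k => le_etw_theta (k + 1)
  have wall_z : ∀ i, 2 ≤ i → i ≤ (zGraph i).wallImmersionNumber := fun i hi =>
    (isImmersion_wall_zGraph hi).le_wallImmersionNumber hi
  -- The index exceeds `(k + 1) * k`, as the quadratic bound requires, and is at least 2, as walls
  -- require.
  have tcw_z : ∀ k, k < (zGraph ((k + 1) * k + 2)).tcw := fun k =>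
    lt_tcw_thetaBouquet (lt_of_lt_of_le (by omega) (le_card_edges_wall (Nat.le_add_left 2 _)))
  have etw_z : ∀ i, (zGraph i).etw ≤ 3 := fun i => etw_thetaBouquet_le _
  refine ⟨⟨?_, ?_⟩, ⟨?_, ?_⟩, ⟨2, fun i _ => tcw_theta i⟩, ⟨2, fun i _ => wall_theta i⟩,
    fun k => ⟨k + 1, by omega, etw_theta k⟩, fun i hi => isImmersion_wall_zGraph hi, wall_z,
    fun k => ⟨(k + 1) * k + 2, by omega, tcw_z k⟩, ⟨3, fun i _ => etw_z i⟩⟩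
  · exact GraphParameter.not_upperBounded 2 fun k => ⟨_, theta (k + 1), etw_theta k, tcw_theta _⟩
  · exact GraphParameter.not_upperBounded 3 fun k => ⟨_, _, tcw_z k, etw_z _⟩
  · exact GraphParameter.not_upperBounded 2 fun k => ⟨_, theta (k + 1), etw_theta k, wall_theta _⟩
  · exact GraphParameter.not_upperBounded 3 fun k =>
      ⟨_, zGraph (k + 2), (by omega : k < k + 2).trans_le (wall_z _ (by omega)), etw_z _⟩
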